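/- Let $d>0$. For every integer $n\ge d$ let $A_n$ be a random $n\times n$ matrix whose $n^2$ entries are independent $\mathrm{Bernoulli}(d/n)$ random variables (each entry equals $1$ with probability $d/n$ and $0$ with probability $1-d/n$). Let $(Y_\ell)_{\ell\ge 1}$ be independent random variables with $Y_\ell\sim\mathrm{Poisson}(d^\ell/\ell)$, and for every integer $k\ge 1$ put $X_k=\sum_{\ell\mid k}\ell\,Y_\ell$, the sum being over the positive divisors $\ell$ of $k$. Then for every fixed integer $k\ge 1$, as $n\to\infty$, \[ \bigl(\operatorname{tr}(A_n),\operatorname{tr}(A_n^2),\dots,\operatorname{tr}(A_n^k)\bigr)\longrightarrow (X_1,X_2,\dots,X_k) \] jointly in law, i.e. the laws of the random vectors on the left converge weakly, as probability measures on $\mathbb{R}^k$, to the law of $(X_1,\dots,X_k)$. -/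

import Mathlib

/-- The random variable `X_k = ∑_{ℓ ∣ k} ℓ Y_ℓ` built from a family `Y_1, Y_2, …` of random
variables with values in the natural numbers. The value `Y 0` is never used when `k ≥ 1`. -/
def divisorSum {Ω : Type*} (Y : ℕ → Ω → ℕ) (k : ℕ) (ω : Ω) : ℕ :=
  ∑ ℓ ∈ k.divisors, ℓ * Y ℓ ω

/-! Regard `A n` as the adjacency matrix of a random digraph `S` on `n` vertices with edge
probability `p = d / n`. Traces of powers count closed walks, so a linear combination of traces is
`weightedWalks θ k S`. By Lévy's continuity theorem it suffices to find the limit of its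
characteristic function `walkCharFun`, at the single point `t = 1` for every `θ`.

This is done by a differential equation in `t` instead of by moments. Differentiation brings down a
sum over closed walks `u`; conditioning on the presence of `u` plants its edges at the price `p ^
#(walkEdges u)` (`hasDerivAt_walkCharFun`). Walks with more edges than vertices contribute `O(p)` in
total. A walk with as many edges as vertices runs along a cycle (`exists_eq_wrap`), and planting a
cycle just adds the cycle's own weight, except with probability `O(p)`: a closed walk that mixes
cycle edges with others has more edges than vertices outside the cycle (`card_walkVerts_sdiff_lt`).
Hence `φ' = g φ + o(1)` with `φ 0 = 1` (`norm_deriv_walkCharFun_sub_le`), and `φ` tends to `exp G`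
with `G' = g` and `G 0 = 0` (`tendsto_of_approx_linear_ode`). This exponential is the characteristic
function of the same combination of the `divisorSum`s (`integral_exp_divisorSum`). -/

open Finset in
/-- The probability of `S` under the law of the random subset of `α` that contains each element
independently with probability `p`. -/
noncomputable def bernoulliWeight {α : Type*} [Fintype α] [DecidableEq α] (p : ℝ)
    (S : Finset α) : ℝ :=
  ∏ e, if e ∈ S then p else 1 - p

/-! ### Random subsets: conditioning on containing a given set -/

section BernoulliWeight

open Finset

variable {α : Type*} [Fintype α] [DecidableEq α] {E : Type*} [AddCommGroup E] [Module ℝ E]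
  {p : ℝ}

theorem bernoulliWeight_nonneg (hp0 : 0 ≤ p) (hp1 : p ≤ 1) (S : Finset α) :
    0 ≤ bernoulliWeight p S := by
  refine prod_nonneg fun e _ => ?_
  split_ifs <;> linarith

/-- Expand `∏ e, (a e + (1 - a e))`. -/
theorem sum_prod_ite_mem (a : α → ℝ) :
    ∑ S : Finset α, ∏ e, (if e ∈ S then a e else 1 - a e) = 1 := by
  have h := Finset.prod_add a (fun e => 1 - a e) (univ : Finset α)
  simp only [add_sub_cancel, prod_const_one, powerset_univ] at h
  refine Eq.trans ?_ h.symm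
  refine sum_congr rfl fun S _ => ?_
  rw [Finset.prod_ite]
  congr 1
  · congr 1; ext; simp
  · congr 1; ext; simp

theorem sum_bernoulliWeight : ∑ S : Finset α, bernoulliWeight p S = 1 :=
  sum_prod_ite_mem fun _ => p

theorem sum_finset_eq_sum_erase {M : Type*} [AddCommMonoid M] (e : α) (f : Finset α → M) :
    ∑ S : Finset α, f S = ∑ S ∈ (univ.erase e).powerset, (f S + f (insert e S)) := by
  rw [sum_add_distrib, ← sum_powerset_insert (notMem_erase e univ), insert_erase (mem_univ e),
    powerset_univ]

theorem sum_bernoulliWeight_smul_of_mem (e : α) (F : Finset α → E) :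
    ∑ S : Finset α, bernoulliWeight p S • (if e ∈ S then F S else 0) =
      p • ∑ S : Finset α, bernoulliWeight p S • F (insert e S) := by
  rw [sum_finset_eq_sum_erase e, sum_finset_eq_sum_erase e, smul_sum]
  refine sum_congr rfl fun S hS => ?_
  have he : e ∉ S := fun h => by simpa using mem_powerset.1 hS h
  have h1 : ∀ T : Finset α, bernoulliWeight p T = (if e ∈ T then p else 1 - p) *
      ∏ x ∈ univ.erase e, (if x ∈ T then p else 1 - p) := fun T =>
    (mul_prod_erase univ (fun x => if x ∈ T then p else 1 - p) (mem_univ e)).symm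
  have h2 : ∏ x ∈ univ.erase e, (if x ∈ insert e S then p else 1 - p) =
      ∏ x ∈ univ.erase e, (if x ∈ S then p else 1 - p) := by
    refine prod_congr rfl fun x hx => ?_
    simp [mem_insert, ne_of_mem_erase hx]
  rw [h1 S, h1 (insert e S), h2]
  simp only [he, mem_insert_self, if_true, if_false, smul_zero, zero_add, insert_idem]
  rw [← add_smul, smul_smul]
  congr 1
  ring

/-- Given that the random set contains `W`, the rest of it is still a fresh Bernoulli set. This
turns the derivative of the characteristic function into a sum over planted walks. -/
theorem sum_bernoulliWeight_smul_of_subset (W : Finset α) (F : Finset α → E) :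
    ∑ S : Finset α, bernoulliWeight p S • (if W ⊆ S then F S else 0) =
      p ^ #W • ∑ S : Finset α, bernoulliWeight p S • F (S ∪ W) := by
  induction W using Finset.induction_on generalizing F with
  | empty => simp
  | insert e W he ih =>
    have h1 : ∀ S : Finset α, (if insert e W ⊆ S then F S else 0) =
        if e ∈ S then (if W ⊆ S then F S else 0) else 0 := fun S => by
      by_cases h : e ∈ S <;> simp [insert_subset_iff, h]
    simp_rw [h1]
    rw [sum_bernoulliWeight_smul_of_mem e fun S => if W ⊆ S then F S else 0]
    have h2 : ∀ S : Finset α, (if W ⊆ insert e S then F (insert e S) else 0) =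
        if W ⊆ S then F (insert e S) else 0 := fun S => by
      simp only [subset_insert_iff_of_notMem he]
    simp_rw [h2]
    rw [ih fun S => F (insert e S), smul_smul, card_insert_of_notMem he, pow_succ']
    simp_rw [union_insert]

theorem sum_bernoulliWeight_of_subset (W : Finset α) :
    ∑ S : Finset α, (if W ⊆ S then bernoulliWeight p S else 0) = p ^ #W := by
  have h := sum_bernoulliWeight_smul_of_subset (p := p) W fun _ => (1 : ℝ)
  simpa [sum_bernoulliWeight] using h

end BernoulliWeight

/-! ### Closed walks, traces, and a weighted count of walks -/

section ClosedWalks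

open Finset

variable {V : Type*} [DecidableEq V] {m : ℕ}

/-- The set of directed edges of the closed walk `u 0, u 1, …, u m, u 0`. -/
def walkEdges (u : Fin (m + 1) → V) : Finset (V × V) := univ.image fun i => (u i, u (i + 1))

/-- The set of vertices of a walk. -/
def walkVerts {m : ℕ} (u : Fin m → V) : Finset V := univ.image u

/-- The number of closed walks with `m + 1` steps that use edges in `S` only. -/
def numClosedWalks [Fintype V] (m : ℕ) (S : Finset (V × V)) : ℕ :=
  #{u : Fin (m + 1) → V | walkEdges u ⊆ S}

theorem mk_mem_walkEdges (u : Fin (m + 1) → V) (i : Fin (m + 1)) :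
    (u i, u (i + 1)) ∈ walkEdges u := mem_image_of_mem _ (mem_univ i)

theorem walkEdges_nonempty (u : Fin (m + 1) → V) : (walkEdges u).Nonempty :=
  ⟨_, mk_mem_walkEdges u 0⟩

theorem image_fst_walkEdges (u : Fin (m + 1) → V) :
    (walkEdges u).image Prod.fst = walkVerts u := by
  rw [walkEdges, walkVerts, image_image]; rfl

theorem card_walkVerts_le (u : Fin (m + 1) → V) : #(walkVerts u) ≤ #(walkEdges u) := by
  rw [← image_fst_walkEdges]; exact card_image_le

theorem card_walkEdges_le (u : Fin (m + 1) → V) : #(walkEdges u) ≤ m + 1 :=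
  card_image_le.trans (by simp)

theorem mem_walkVerts {m : ℕ} (u : Fin m → V) (i : Fin m) : u i ∈ walkVerts u :=
  mem_image_of_mem _ (mem_univ i)

section Trace

variable [Fintype V] {R : Type*} [CommRing R]

/-- The free function `g` of the endpoints lets the induction absorb the last step into `g`; taking
`g x y = A y x` later closes the walk. -/
theorem sum_prod_walk_eq (A : Matrix V V R) (g : V → V → R) (j : ℕ) :
    ∑ u : Fin (j + 1) → V, (∏ i : Fin j, A (u i.castSucc) (u i.succ)) * g (u 0) (u (Fin.last j)) =
      ∑ x, ∑ y, (A ^ j) x y * g x y := by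
  induction j generalizing g with
  | zero =>
    rw [← (Equiv.funUnique (Fin 1) V).symm.sum_comp]
    simp [Matrix.one_apply, Equiv.funUnique]
  | succ j ih =>
    rw [← (Fin.snocEquiv fun _ : Fin (j + 2) => V).sum_comp, Fintype.sum_prod_type_right]
    have : ∀ u : Fin (j + 1) → V, ∑ z : V,
        (∏ i : Fin (j + 1), A ((Fin.snocEquiv fun _ : Fin (j + 2) => V) (z, u) i.castSucc)
          ((Fin.snocEquiv fun _ : Fin (j + 2) => V) (z, u) i.succ)) *
          g ((Fin.snocEquiv fun _ : Fin (j + 2) => V) (z, u) 0)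
            ((Fin.snocEquiv fun _ : Fin (j + 2) => V) (z, u) (Fin.last (j + 1))) =
        (∏ i : Fin j, A (u i.castSucc) (u i.succ)) *
          ∑ z, A (u (Fin.last j)) z * g (u 0) z := by
      intro u
      rw [mul_sum]
      refine sum_congr rfl fun z _ => ?_
      simp only [Fin.snocEquiv, Equiv.coe_fn_mk, Fin.prod_univ_castSucc]
      simp only [Fin.snoc_castSucc, Fin.snoc_last, Fin.succ_last, ← Fin.castSucc_zero,
        ← Fin.castSucc_succ]
      rw [mul_assoc]
    simp_rw [this]
    rw [ih fun x y => ∑ z, A y z * g x z]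
    refine sum_congr rfl fun x _ => ?_
    simp_rw [pow_succ, Matrix.mul_apply, mul_sum, sum_mul]
    rw [sum_comm]
    simp_rw [mul_assoc]

theorem trace_pow_succ_eq_sum (A : Matrix V V R) (j : ℕ) :
    (A ^ (j + 1)).trace = ∑ u : Fin (j + 1) → V, ∏ i, A (u i) (u (i + 1)) := by
  have h := sum_prod_walk_eq A (fun x y => A y x) j
  rw [pow_succ, Matrix.trace]
  simp_rw [Matrix.diag_apply, Matrix.mul_apply]
  rw [← h]
  refine sum_congr rfl fun u _ => ?_
  rw [Fin.prod_univ_castSucc]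
  simp

theorem trace_indicator_pow_succ (S : Finset (V × V)) (j : ℕ) :
    ((Matrix.of fun x y => if (x, y) ∈ S then (1 : R) else 0) ^ (j + 1)).trace =
      (numClosedWalks j S : R) := by
  rw [trace_pow_succ_eq_sum, numClosedWalks, card_filter, Nat.cast_sum]
  refine sum_congr rfl fun u _ => ?_
  simp only [Matrix.of_apply, walkEdges, image_subset_iff, mem_univ, true_implies, prod_ite_zero,
    prod_const_one, Nat.cast_ite, Nat.cast_one, Nat.cast_zero]

end Trace

/-- The total weight of the walks, a walk counting `p` for each vertex outside `V₀`. -/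
theorem sum_pow_card_walkVerts_sdiff_le [Fintype V] {p d : ℝ} (hp : 0 ≤ p)
    (hpd : Fintype.card V * p ≤ d) (V₀ : Finset V) (m : ℕ) :
    ∑ u : Fin m → V, p ^ #(walkVerts u \ V₀) ≤ (#V₀ + m + d) ^ m := by
  have hd : 0 ≤ d := le_trans (by positivity) hpd
  induction m with
  | zero => simp [walkVerts]
  | succ m ih =>
    rw [← (Fin.consEquiv fun _ : Fin (m + 1) => V).sum_comp, Fintype.sum_prod_type_right]
    have hcons : ∀ (x : V) (u : Fin m → V),
        walkVerts ((Fin.consEquiv fun _ : Fin (m + 1) => V) (x, u)) = insert x (walkVerts u) := by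
      intro x u
      ext y
      simp [walkVerts, Fin.consEquiv, Fin.exists_fin_succ, eq_comm]
    have hstep : ∀ u : Fin m → V,
        ∑ x : V, p ^ #(insert x (walkVerts u) \ V₀) ≤
          p ^ #(walkVerts u \ V₀) * (#V₀ + m + d) := by
      intro u
      -- A vertex of `V₀` or of `u` costs nothing, with at most `#V₀ + m` choices; any other vertex
      -- costs a factor `p`, which sums to at most `d`.
      have hx : ∀ x : V, p ^ #(insert x (walkVerts u) \ V₀) ≤
          p ^ #(walkVerts u \ V₀) * ((if x ∈ V₀ ∪ walkVerts u then 1 else 0) + p) := by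
        intro x
        by_cases h : x ∈ V₀ ∪ walkVerts u
        · have : insert x (walkVerts u) \ V₀ = walkVerts u \ V₀ := by
            rcases mem_union.1 h with h | h
            · rw [insert_sdiff_of_mem _ h]
            · rw [insert_eq_of_mem h]
          rw [this, if_pos h]
          nlinarith [pow_nonneg hp #(walkVerts u \ V₀)]
        · have h' := not_or.1 (fun h' => h (mem_union.2 h'))
          rw [insert_sdiff_of_notMem _ h'.1, card_insert_of_notMem (by simp [h'.2]), if_neg h,
            zero_add, pow_succ]
      refine (sum_le_sum fun x _ => hx x).trans ?_
      rw [← mul_sum, sum_add_distrib, sum_boole, sum_const, nsmul_eq_mul, card_univ]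
      refine mul_le_mul_of_nonneg_left (add_le_add ?_ hpd) (by positivity)
      have h1 : #(V₀ ∪ walkVerts u) ≤ #V₀ + m :=
        (card_union_le _ _).trans (Nat.add_le_add_left (card_image_le.trans (by simp)) _)
      rw [filter_mem_eq_inter, univ_inter]
      exact_mod_cast h1
    simp_rw [hcons]
    refine (sum_le_sum fun u _ => hstep u).trans ?_
    rw [← sum_mul, pow_succ]
    push_cast
    have hb : (#V₀ + m + d : ℝ) ≤ #V₀ + (m + 1) + d := by linarith
    refine mul_le_mul (ih.trans (pow_le_pow_left₀ (by positivity) hb _)) hb (by positivity)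
      (by positivity)

end ClosedWalks

/-! ### Walks that run along cycles -/

section CyclicWalks

open Finset

variable {V : Type*} [DecidableEq V] {m q : ℕ}

theorem Fin.forall_of_forall_add_one {P : Fin (m + 1) → Prop} {i₀ : Fin (m + 1)} (h₀ : P i₀)
    (h : ∀ i, P i → P (i + 1)) (i : Fin (m + 1)) : P i := by
  have key : ∀ a : ℕ, P (i₀ + Fin.ofNat (m + 1) a) := by
    intro a
    induction a with
    | zero => simpa using h₀
    | succ a ih =>
      have : i₀ + Fin.ofNat (m + 1) (a + 1) = i₀ + Fin.ofNat (m + 1) a + 1 := by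
        rw [add_assoc]; congr 1; ext; simp [Fin.val_add]
      rw [this]
      exact h _ ih
  have := key (i - i₀).val
  simpa using this

/-- A walk that shares an edge with `w` but is not contained in `w` has, outside `w`, more edges
than vertices. -/
theorem card_walkVerts_sdiff_lt {m' : ℕ} (w : Fin (m' + 1) → V) (u : Fin (m + 1) → V)
    (hmeet : ¬ Disjoint (walkEdges u) (walkEdges w)) (hsub : ¬ walkEdges u ⊆ walkEdges w) :
    #(walkVerts u \ walkVerts w) + 1 ≤ #(walkEdges u \ walkEdges w) := by
  have hfst : ∀ e ∈ walkEdges w, e.1 ∈ walkVerts w ∧ e.2 ∈ walkVerts w := by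
    intro e he
    obtain ⟨i, -, rfl⟩ := mem_image.1 he
    exact ⟨mem_walkVerts w i, mem_walkVerts w (i + 1)⟩
  -- Some edge of `u` leaves `w`: otherwise `u`, once on `w` at the shared edge, would follow edges
  -- of `w` forever. Its source is not counted on the left, while sources of edges outside `w`
  -- already cover all vertices outside `w`; this gives the `+ 1`.
  have hex : ∃ e ∈ walkEdges u \ walkEdges w, e.1 ∈ walkVerts w := by
    by_contra! hne
    have hin : ∀ i, u i ∈ walkVerts w → (u i, u (i + 1)) ∈ walkEdges w := by
      intro i hi
      by_contra hi'
      exact hne _ (mem_sdiff.2 ⟨mk_mem_walkEdges u i, hi'⟩) hi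
    obtain ⟨e, he, hew⟩ := not_disjoint_iff.1 hmeet
    obtain ⟨i₀, -, rfl⟩ := mem_image.1 he
    have hall := Fin.forall_of_forall_add_one (P := fun i => u i ∈ walkVerts w)
      (hfst _ hew).1 fun i hi => (hfst _ (hin i hi)).2
    refine hsub fun e he => ?_
    obtain ⟨i, -, rfl⟩ := mem_image.1 he
    exact hin i (hall i)
  obtain ⟨e, he, hew⟩ := hex
  have hnot : e.1 ∉ walkVerts u \ walkVerts w := fun h => (mem_sdiff.1 h).2 hew
  rw [← card_insert_of_notMem hnot]
  refine (card_le_card ?_).trans (card_image_le (f := Prod.fst))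
  intro x hx
  rcases mem_insert.1 hx with rfl | hx
  · exact mem_image_of_mem _ he
  · obtain ⟨hxu, hxw⟩ := mem_sdiff.1 hx
    obtain ⟨i, -, rfl⟩ := mem_image.1 hxu
    exact mem_image.2 ⟨(u i, u (i + 1)), mem_sdiff.2
      ⟨mk_mem_walkEdges u i, fun h => hxw (hfst _ h).1⟩, rfl⟩

/-- The periodic extension of a closed walk. -/
def unroll (u : Fin (m + 1) → V) (i : ℕ) : V := u (Fin.ofNat (m + 1) i)

/-- The closed walk with `m + 1` steps that runs along the closed walk `v`. -/
def wrap (m : ℕ) (v : Fin (q + 1) → V) (i : Fin (m + 1)) : V := unroll v i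

theorem Fin.ofNat_add_one (m i : ℕ) :
    Fin.ofNat (m + 1) (i + 1) = Fin.ofNat (m + 1) i + 1 := by
  ext; simp [Fin.val_add]

theorem unroll_val {V : Type*} (u : Fin (m + 1) → V) (i : Fin (m + 1)) : unroll u i = u i := by
  simp [unroll]

theorem unroll_period {V : Type*} (u : Fin (m + 1) → V) : unroll u (m + 1) = unroll u 0 := by
  simp [unroll, Fin.ofNat]

theorem unroll_wrap {V : Type*} (hdvd : q + 1 ∣ m + 1) (v : Fin (q + 1) → V) (i : ℕ) :
    unroll (wrap m v) i = unroll v i := by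
  simp only [unroll, wrap, Fin.ofNat]
  congr 2
  exact Nat.mod_mod_of_dvd i hdvd

theorem wrap_injective {V : Type*} (hdvd : q + 1 ∣ m + 1) :
    Function.Injective (wrap m : (Fin (q + 1) → V) → _) := by
  intro v v' h
  funext i
  rw [← unroll_val v, ← unroll_val v', ← unroll_wrap hdvd, ← unroll_wrap hdvd, h]

theorem mem_walkEdges_iff_unroll (u : Fin (m + 1) → V) (e : V × V) :
    e ∈ walkEdges u ↔ ∃ i : ℕ, (unroll u i, unroll u (i + 1)) = e := by
  constructor
  · intro he
    obtain ⟨i, -, rfl⟩ := mem_image.1 he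
    refine ⟨i, ?_⟩
    rw [unroll_val, unroll, Fin.ofNat_add_one, Fin.ofNat_val_eq_self]
  · rintro ⟨i, rfl⟩
    simp only [unroll, Fin.ofNat_add_one]
    exact mk_mem_walkEdges u _

theorem mem_walkVerts_iff_unroll (u : Fin (m + 1) → V) (x : V) :
    x ∈ walkVerts u ↔ ∃ i : ℕ, unroll u i = x := by
  constructor
  · intro hx
    obtain ⟨i, -, rfl⟩ := mem_image.1 hx
    exact ⟨i, unroll_val u i⟩
  · rintro ⟨i, rfl⟩
    exact mem_walkVerts u _

theorem walkEdges_wrap (hdvd : q + 1 ∣ m + 1) (v : Fin (q + 1) → V) :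
    walkEdges (wrap m v) = walkEdges v := by
  ext e
  simp_rw [mem_walkEdges_iff_unroll, unroll_wrap hdvd]

theorem walkVerts_wrap (hdvd : q + 1 ∣ m + 1) (v : Fin (q + 1) → V) :
    walkVerts (wrap m v) = walkVerts v := by
  ext e
  simp_rw [mem_walkVerts_iff_unroll, unroll_wrap hdvd]

theorem card_walkVerts_of_injective {v : Fin (q + 1) → V} (hv : Function.Injective v) :
    #(walkVerts v) = q + 1 := by
  rw [walkVerts, card_image_of_injective _ hv, card_univ, Fintype.card_fin]

theorem card_walkEdges_of_injective {v : Fin (q + 1) → V} (hv : Function.Injective v) :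
    #(walkEdges v) = q + 1 := by
  rw [walkEdges, card_image_of_injective _ fun i j h => hv (Prod.ext_iff.1 h).1, card_univ,
    Fintype.card_fin]

theorem walkEdges_rotate (v : Fin (q + 1) → V) (a : Fin (q + 1)) :
    walkEdges (fun i => v (a + i)) = walkEdges v := by
  ext e
  simp only [walkEdges, mem_image, mem_univ, true_and]
  constructor
  · rintro ⟨i, rfl⟩
    exact ⟨a + i, by rw [add_assoc]⟩
  · rintro ⟨i, rfl⟩
    exact ⟨i - a, by rw [← add_assoc, add_sub_cancel]⟩

/-- A walk inside a cycle follows the cycle. -/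
theorem exists_eq_rotate {v : Fin (q + 1) → V} (hv : Function.Injective v)
    {u : Fin (m + 1) → V} (hu : walkEdges u ⊆ walkEdges v) :
    ∃ a, ∀ i, unroll u i = unroll (fun i => v (a + i)) i := by
  have hedge : ∀ i, ∃ b, (v b, v (b + 1)) = (unroll u i, unroll u (i + 1)) := by
    intro i
    obtain ⟨b, -, hb⟩ := mem_image.1 (hu ((mem_walkEdges_iff_unroll u _).2 ⟨i, rfl⟩))
    exact ⟨b, hb⟩
  obtain ⟨a, ha⟩ := hedge 0
  refine ⟨a, fun i => ?_⟩
  induction i with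
  | zero => simpa [unroll] using (Prod.ext_iff.1 ha).1.symm
  | succ i ih =>
    obtain ⟨b, hb⟩ := hedge i
    obtain ⟨hb1, hb2⟩ := Prod.ext_iff.1 hb
    simp only at hb1 hb2
    -- By injectivity each vertex of the cycle has only one outgoing edge.
    have : b = a + Fin.ofNat (q + 1) i := hv (hb1.trans ih)
    rw [← hb2, this, unroll, Fin.ofNat_add_one, add_assoc]

/-- A walk in a cycle is determined by its starting vertex, and it closes up exactly when its length
is a multiple of the cycle length. -/
theorem numClosedWalks_walkEdges_of_injective [Fintype V] {v : Fin (q + 1) → V}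
    (hv : Function.Injective v) (m : ℕ) :
    numClosedWalks m (walkEdges v) = if q + 1 ∣ m + 1 then q + 1 else 0 := by
  have hrot : ∀ a, Function.Injective fun i => v (a + i) := fun a i j h => by
    simpa using hv h
  split_ifs with hdvd
  · have himage : ({u : Fin (m + 1) → V | walkEdges u ⊆ walkEdges v} : Finset _) =
        univ.image fun a => wrap m fun i => v (a + i) := by
      ext u
      simp only [mem_filter, mem_univ, true_and, mem_image]
      constructor
      · intro hu
        obtain ⟨a, ha⟩ := exists_eq_rotate hv hu
        refine ⟨a, funext fun i => ?_⟩
        rw [wrap, ← ha, unroll_val]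
      · rintro ⟨a, rfl⟩
        rw [walkEdges_wrap hdvd, walkEdges_rotate]
    rw [numClosedWalks, himage, card_image_of_injective, card_univ, Fintype.card_fin]
    intro a b hab
    have h := congrFun (wrap_injective hdvd hab) 0
    simpa using hv h
  · rw [numClosedWalks, card_eq_zero, filter_eq_empty_iff]
    intro u _ hu
    obtain ⟨a, ha⟩ := exists_eq_rotate hv hu
    have h := hrot a ((ha (m + 1)).symm.trans ((unroll_period u).trans (ha 0)))
    apply hdvd
    simpa [Fin.ext_iff, Nat.dvd_iff_mod_eq_zero] using h

/-- A closed walk with as many edges as vertices runs along a cycle. -/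
theorem exists_eq_wrap {u : Fin (m + 1) → V} (hu : #(walkEdges u) = #(walkVerts u)) :
    ∃ q, q + 1 ∣ m + 1 ∧ ∃ v : Fin (q + 1) → V, Function.Injective v ∧ u = wrap m v := by
  -- Equality of the counts means one outgoing edge per vertex, so each vertex determines the next
  -- one and the walk is periodic. The cycle length `q + 1` is the first return time to the start.
  have hinj : Set.InjOn Prod.fst (walkEdges u : Set (V × V)) := by
    rw [← card_image_iff, image_fst_walkEdges, hu]
  have hnext : ∀ a b, unroll u a = unroll u b → unroll u (a + 1) = unroll u (b + 1) := by
    intro a b h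
    have := hinj (mem_coe.2 ((mem_walkEdges_iff_unroll u _).2 ⟨a, rfl⟩))
      (mem_coe.2 ((mem_walkEdges_iff_unroll u _).2 ⟨b, rfl⟩)) h
    exact (Prod.ext_iff.1 this).2
  have hshift : ∀ a b c, unroll u a = unroll u b → unroll u (a + c) = unroll u (b + c) := by
    intro a b c h
    induction c with
    | zero => exact h
    | succ c ih => exact hnext _ _ ih
  have hex : ∃ q, unroll u (q + 1) = unroll u 0 := ⟨m, unroll_period u⟩
  classical
  obtain ⟨q, hq, hmin⟩ : ∃ q, unroll u (q + 1) = unroll u 0 ∧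
      ∀ r < q, unroll u (r + 1) ≠ unroll u 0 :=
    ⟨Nat.find hex, Nat.find_spec hex, fun r hr => Nat.find_min hex hr⟩
  have hper : Function.Periodic (unroll u) (q + 1) := fun a => by
    have := hshift (q + 1) 0 a hq
    rwa [zero_add, add_comm] at this
  have hdvd : q + 1 ∣ m + 1 := by
    have h := (hper.map_mod_nat (m + 1)).trans (unroll_period u)
    rw [Nat.dvd_iff_mod_eq_zero]
    by_contra h0
    obtain ⟨r, hr⟩ := Nat.exists_eq_succ_of_ne_zero h0
    have hlt : (m + 1) % (q + 1) < q + 1 := Nat.mod_lt _ (Nat.succ_pos q)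
    refine hmin r (by omega) ?_
    rwa [hr] at h
  -- A repetition at times `a < b`, shifted by `q + 1 - b`, would be a return to the start before
  -- time `q + 1`.
  have hlt : ∀ a b : ℕ, a < b → b < q + 1 → unroll u a ≠ unroll u b := by
    intro a b hab hb h
    have h1 := hshift a b (q + 1 - b) h
    rw [show b + (q + 1 - b) = q + 1 by omega, hq,
      show a + (q + 1 - b) = (a + (q - b)) + 1 by omega] at h1
    exact hmin _ (by omega) h1
  refine ⟨q, hdvd, fun i => unroll u i, ?_, ?_⟩
  · intro a b h
    simp only at h
    rcases lt_trichotomy a.val b.val with hab | hab | hab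
    · exact absurd h (hlt _ _ hab b.2)
    · exact Fin.ext hab
    · exact absurd h.symm (hlt _ _ hab a.2)
  · funext i
    rw [wrap, unroll, Fin.val_ofNat, hper.map_mod_nat, unroll_val]

variable [Fintype V]

theorem numClosedWalks_walkEdges {u : Fin (m + 1) → V} (hu : #(walkEdges u) = #(walkVerts u))
    (j : ℕ) :
    numClosedWalks j (walkEdges u) = if #(walkVerts u) ∣ j + 1 then #(walkVerts u) else 0 := by
  obtain ⟨q, hdvd, v, hv, rfl⟩ := exists_eq_wrap hu
  rw [walkEdges_wrap hdvd, walkVerts_wrap hdvd, card_walkVerts_of_injective hv,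
    numClosedWalks_walkEdges_of_injective hv]

theorem card_cyclicWalks (m q : ℕ) :
    #{u : Fin (m + 1) → V | #(walkEdges u) = #(walkVerts u) ∧ #(walkVerts u) = q + 1} =
      if q + 1 ∣ m + 1 then (Fintype.card V).descFactorial (q + 1) else 0 := by
  split_ifs with hdvd
  · have hcard := Fintype.card_embedding_eq (α := Fin (q + 1)) (β := V)
    rw [Fintype.card_fin] at hcard
    rw [← hcard, ← card_univ]
    refine (card_bij (fun (v : Fin (q + 1) ↪ V) _ => wrap m v) ?_ ?_ ?_).symm
    · intro v _
      simp [walkEdges_wrap hdvd, walkVerts_wrap hdvd, card_walkVerts_of_injective v.injective,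
        card_walkEdges_of_injective v.injective]
    · intro v _ v' _ h
      exact DFunLike.coe_injective (wrap_injective hdvd h)
    · intro u hu
      obtain ⟨hu1, hu2⟩ := (mem_filter.1 hu).2
      obtain ⟨q', hdvd', v, hv, rfl⟩ := exists_eq_wrap hu1
      rw [walkVerts_wrap hdvd', card_walkVerts_of_injective hv] at hu2
      obtain rfl : q' = q := by omega
      exact ⟨⟨v, hv⟩, mem_univ _, rfl⟩
  · rw [card_eq_zero, filter_eq_empty_iff]
    rintro u - ⟨hu1, hu2⟩
    obtain ⟨q', hdvd', v, hv, rfl⟩ := exists_eq_wrap hu1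
    rw [walkVerts_wrap hdvd', card_walkVerts_of_injective hv] at hu2
    exact hdvd (hu2 ▸ hdvd')

theorem sum_cyclicWalks {M : Type*} [AddCommMonoid M] (m : ℕ) (F : ℕ → M) :
    ∑ u : Fin (m + 1) → V with #(walkEdges u) = #(walkVerts u), F #(walkVerts u) =
      ∑ q ∈ range (m + 1), (if q + 1 ∣ m + 1 then (Fintype.card V).descFactorial (q + 1) else 0) •
        F (q + 1) := by
  have hpos : ∀ u : Fin (m + 1) → V, 1 ≤ #(walkVerts u) := fun u =>
    card_pos.2 ⟨u 0, mem_walkVerts u 0⟩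
  rw [← sum_fiberwise_of_maps_to (t := range (m + 1)) (g := fun u => #(walkVerts u) - 1)]
  · refine sum_congr rfl fun q _ => ?_
    rw [← card_cyclicWalks, ← sum_const, filter_filter]
    refine sum_congr ?_ fun u hu => ?_
    · ext u
      have := hpos u
      simp only [mem_filter, mem_univ, true_and]
      refine and_congr_right fun _ => ?_
      omega
    · rw [(mem_filter.1 hu).2.2]
  · intro u _
    have h1 := hpos u
    have h2 := card_walkVerts_le u
    have h3 := card_walkEdges_le u
    rw [mem_range]
    omega

end CyclicWalks

/-! ### The characteristic function and its approximate differential equation -/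

section WalkCharFun

open Finset

variable {V : Type*} [Fintype V] [DecidableEq V] {m : ℕ} {p d : ℝ}

/-- The linear combination of the numbers of closed walks in `S` with `1, …, k` steps. -/
noncomputable def weightedWalks (θ : ℕ → ℝ) (k : ℕ) (S : Finset (V × V)) : ℝ :=
  ∑ j ∈ range k, θ j * numClosedWalks j S

/-- The characteristic function of `weightedWalks θ k` on the random digraph with edge
probability `p`. -/
noncomputable def walkCharFun (V : Type*) [Fintype V] [DecidableEq V] (p : ℝ) (θ : ℕ → ℝ) (k : ℕ)
    (t : ℝ) : ℂ :=
  ∑ S : Finset (V × V), bernoulliWeight p S • Complex.exp ((t * weightedWalks θ k S : ℝ) * .I)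

theorem norm_sum_bernoulliWeight_smul_le {α : Type*} [Fintype α] [DecidableEq α] (hp0 : 0 ≤ p)
    (hp1 : p ≤ 1) (F : Finset α → ℂ) (B : Finset α → ℝ) (h : ∀ S, ‖F S‖ ≤ B S) :
    ‖∑ S : Finset α, bernoulliWeight p S • F S‖ ≤ ∑ S : Finset α, bernoulliWeight p S * B S := by
  refine (norm_sum_le _ _).trans (sum_le_sum fun S _ => ?_)
  rw [norm_smul, Real.norm_of_nonneg (bernoulliWeight_nonneg hp0 hp1 S)]
  exact mul_le_mul_of_nonneg_left (h S) (bernoulliWeight_nonneg hp0 hp1 S)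

theorem norm_sum_bernoulliWeight_smul_exp_le {α : Type*} [Fintype α] [DecidableEq α]
    (hp0 : 0 ≤ p) (hp1 : p ≤ 1) (f : Finset α → ℝ) :
    ‖∑ S : Finset α, bernoulliWeight p S • Complex.exp ((f S : ℝ) * .I)‖ ≤ 1 := by
  refine (norm_sum_bernoulliWeight_smul_le hp0 hp1 _ (fun _ => 1) fun S => ?_).trans ?_
  · rw [Complex.norm_exp_ofReal_mul_I]
  · simp [sum_bernoulliWeight]

/-- Without mixed walks, a closed walk in the union avoids `w` or lies in `w`; disjointness of `w`
and `S` prevents double counting. -/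
theorem weightedWalks_union (θ : ℕ → ℝ) (k : ℕ) (w : Fin (m + 1) → V) (S : Finset (V × V))
    (hS : Disjoint (walkEdges w) S)
    (h : ∀ j < k, ∀ u : Fin (j + 1) → V, ¬ Disjoint (walkEdges u) (walkEdges w) →
      ¬ walkEdges u ⊆ walkEdges w → ¬ walkEdges u \ walkEdges w ⊆ S) :
    weightedWalks θ k (S ∪ walkEdges w) =
      weightedWalks θ k S + weightedWalks θ k (walkEdges w) := by
  simp only [weightedWalks]
  rw [← sum_add_distrib]
  refine sum_congr rfl fun j hj => ?_
  rw [← mul_add]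
  congr 1
  norm_cast
  rw [numClosedWalks, numClosedWalks, numClosedWalks, ← card_union_of_disjoint]
  · congr 1
    ext u
    simp only [mem_filter, mem_univ, true_and, mem_union]
    constructor
    · intro hu
      by_cases hd : Disjoint (walkEdges u) (walkEdges w)
      · exact Or.inl (hd.left_le_of_le_sup_right hu)
      · refine Or.inr ?_
        by_contra hsub
        refine h j (mem_range.1 hj) u hd hsub ?_
        exact sdiff_le_iff.2 (hu.trans (union_comm S _).le)
    · rintro (hu | hu)
      · exact hu.trans subset_union_left
      · exact hu.trans subset_union_right
  · rw [disjoint_filter]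
    intro u _ h1 h2
    obtain ⟨e, he⟩ := walkEdges_nonempty u
    exact disjoint_left.1 hS (h2 he) (h1 he)

/-- The constant in the estimates of `walkCharFun`. -/
noncomputable def walkConst (d : ℝ) (k : ℕ) : ℝ :=
  k + ∑ j ∈ range k, (k + (j + 1) + d) ^ (j + 1)

theorem walkConst_nonneg (hd : 0 ≤ d) (k : ℕ) : 0 ≤ walkConst d k := by
  unfold walkConst; positivity

/-- Planting `w` is asymptotically independent of the rest of the digraph: the weight is additive
off an event of probability `O(p)`, uniformly in `t` and `w`. -/
theorem norm_sum_exp_weightedWalks_union_sub_le (hp0 : 0 ≤ p) (hp1 : p ≤ 1)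
    (hpd : Fintype.card V * p ≤ d) (θ : ℕ → ℝ) {k : ℕ} (hm : m < k) (w : Fin (m + 1) → V) (t : ℝ) :
    ‖∑ S : Finset (V × V), bernoulliWeight p S •
        Complex.exp ((t * weightedWalks θ k (S ∪ walkEdges w) : ℝ) * .I) -
      Complex.exp ((t * weightedWalks θ k (walkEdges w) : ℝ) * .I) * walkCharFun V p θ k t‖ ≤
      2 * walkConst d k * p := by
  have hd : 0 ≤ d := le_trans (by positivity) hpd
  -- `B` counts the obstructions to additivity: edges of `w` already in `S`, and mixed walks
  -- completed by `S`. If there are none the exponentials agree; otherwise `B S ≥ 1` and two unit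
  -- complex numbers differ by at most `2`.
  set B : Finset (V × V) → ℝ := fun S => (∑ e ∈ walkEdges w, if {e} ⊆ S then 1 else 0) +
    ∑ j ∈ range k, ∑ u : Fin (j + 1) → V with ¬ Disjoint (walkEdges u) (walkEdges w) ∧
      ¬ walkEdges u ⊆ walkEdges w, if walkEdges u \ walkEdges w ⊆ S then 1 else 0 with hB
  have hB1 : ∀ S, ‖Complex.exp ((t * weightedWalks θ k (S ∪ walkEdges w) : ℝ) * .I) -
      Complex.exp ((t * weightedWalks θ k (walkEdges w) : ℝ) * .I) *
        Complex.exp ((t * weightedWalks θ k S : ℝ) * .I)‖ ≤ 2 * B S := by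
    intro S
    have hn1 : ∀ e ∈ walkEdges w, (0 : ℝ) ≤ if {e} ⊆ S then 1 else 0 := fun e _ => by
      split_ifs <;> norm_num
    have hn2 : ∀ j, ∀ u : Fin (j + 1) → V,
        (0 : ℝ) ≤ if walkEdges u \ walkEdges w ⊆ S then 1 else 0 := fun j u => by
      split_ifs <;> norm_num
    by_cases hgood : Disjoint (walkEdges w) S ∧ ∀ j < k, ∀ u : Fin (j + 1) → V,
        ¬ Disjoint (walkEdges u) (walkEdges w) → ¬ walkEdges u ⊆ walkEdges w →
        ¬ walkEdges u \ walkEdges w ⊆ S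
    · rw [weightedWalks_union θ k w S hgood.1 hgood.2, ← Complex.exp_add, ← add_mul,
        ← Complex.ofReal_add, mul_add, add_comm, sub_self, norm_zero]
      exact mul_nonneg zero_le_two (add_nonneg (sum_nonneg hn1)
        (sum_nonneg fun j _ => sum_nonneg fun u _ => hn2 j u))
    · have h2 : ‖Complex.exp ((t * weightedWalks θ k (S ∪ walkEdges w) : ℝ) * .I) -
          Complex.exp ((t * weightedWalks θ k (walkEdges w) : ℝ) * .I) *
            Complex.exp ((t * weightedWalks θ k S : ℝ) * .I)‖ ≤ 2 := by
        refine (norm_sub_le _ _).trans ?_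
        rw [norm_mul]
        simp only [Complex.norm_exp_ofReal_mul_I]
        norm_num
      have h1 : 1 ≤ B S := by
        rcases not_and_or.1 hgood with hdis | hex
        · obtain ⟨e, he, heS⟩ := not_disjoint_iff.1 hdis
          have := single_le_sum hn1 he
          rw [if_pos (singleton_subset_iff.2 heS)] at this
          exact this.trans (le_add_of_nonneg_right
            (sum_nonneg fun j _ => sum_nonneg fun u _ => hn2 j u))
        · push Not at hex
          obtain ⟨j, hj, u, hu1, hu2, hu3⟩ := hex
          have h4 := single_le_sum (fun j _ => sum_nonneg fun u
            (_ : u ∈ ({u : Fin (j + 1) → V | ¬ Disjoint (walkEdges u) (walkEdges w) ∧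
              ¬ walkEdges u ⊆ walkEdges w} : Finset _)) => hn2 j u) (mem_range.2 hj)
          have h5 := single_le_sum (fun u
            (_ : u ∈ ({u : Fin (j + 1) → V | ¬ Disjoint (walkEdges u) (walkEdges w) ∧
              ¬ walkEdges u ⊆ walkEdges w} : Finset _)) => hn2 j u)
              (mem_filter.2 ⟨mem_univ u, hu1, hu2⟩)
          rw [if_pos hu3] at h5
          exact (h5.trans h4).trans (le_add_of_nonneg_left (sum_nonneg hn1))
      linarith
  have hB2 : ∑ S : Finset (V × V), bernoulliWeight p S * B S ≤ walkConst d k * p := by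
    have heq : ∑ S : Finset (V × V), bernoulliWeight p S * B S =
        (∑ e ∈ walkEdges w, p ^ #{e}) +
          ∑ j ∈ range k, ∑ u : Fin (j + 1) → V with ¬ Disjoint (walkEdges u) (walkEdges w) ∧
            ¬ walkEdges u ⊆ walkEdges w, p ^ #(walkEdges u \ walkEdges w) := by
      simp_rw [← sum_bernoulliWeight_of_subset (p := p), hB, mul_add, mul_sum, sum_add_distrib,
        mul_ite, mul_one, mul_zero]
      rw [sum_comm]
      congr 1
      rw [sum_comm]
      refine sum_congr rfl fun j _ => ?_
      rw [sum_comm]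
    rw [heq, walkConst, add_mul, sum_mul]
    refine add_le_add ?_ (sum_le_sum fun j _ => ?_)
    · simp only [card_singleton, pow_one, sum_const, nsmul_eq_mul]
      refine mul_le_mul_of_nonneg_right ?_ hp0
      exact_mod_cast (card_walkEdges_le w).trans hm
    -- The surplus edge outside `w` supplies the factor `p`; the remaining sum over walks is bounded
    -- independently of the size of `V`.
    · have hbound : ∀ u ∈ ({u : Fin (j + 1) → V | ¬ Disjoint (walkEdges u) (walkEdges w) ∧
            ¬ walkEdges u ⊆ walkEdges w} : Finset _), p ^ #(walkEdges u \ walkEdges w) ≤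
          p ^ #(walkVerts u \ walkVerts w) * p := by
        intro u hu
        obtain ⟨hu1, hu2⟩ := (mem_filter.1 hu).2
        rw [← pow_succ]
        exact pow_le_pow_of_le_one hp0 hp1 (card_walkVerts_sdiff_lt w u hu1 hu2)
      refine (sum_le_sum hbound).trans ?_
      rw [← sum_mul]
      refine mul_le_mul_of_nonneg_right ?_ hp0
      refine (sum_le_univ_sum_of_nonneg fun u => by positivity).trans ?_
      refine (sum_pow_card_walkVerts_sdiff_le hp0 hpd (walkVerts w) (j + 1)).trans ?_
      refine pow_le_pow_left₀ (by positivity) ?_ _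
      have h1 : (#(walkVerts w) : ℝ) ≤ k := by
        exact_mod_cast ((card_walkVerts_le w).trans (card_walkEdges_le w)).trans hm
      push_cast
      linarith
  have hsum : ∑ S : Finset (V × V), bernoulliWeight p S •
        Complex.exp ((t * weightedWalks θ k (S ∪ walkEdges w) : ℝ) * .I) -
      Complex.exp ((t * weightedWalks θ k (walkEdges w) : ℝ) * .I) * walkCharFun V p θ k t =
      ∑ S : Finset (V × V), bernoulliWeight p S •
        (Complex.exp ((t * weightedWalks θ k (S ∪ walkEdges w) : ℝ) * .I) -
      Complex.exp ((t * weightedWalks θ k (walkEdges w) : ℝ) * .I) *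
        Complex.exp ((t * weightedWalks θ k S : ℝ) * .I)) := by
    rw [walkCharFun, mul_sum, ← sum_sub_distrib]
    refine sum_congr rfl fun S _ => ?_
    rw [smul_sub, mul_smul_comm]
  rw [hsum]
  refine (norm_sum_bernoulliWeight_smul_le hp0 hp1 _ _ hB1).trans ?_
  simp_rw [mul_left_comm _ (2 : ℝ), ← mul_sum]
  rw [mul_assoc]
  exact mul_le_mul_of_nonneg_left hB2 zero_le_two

/-- The value of `weightedWalks θ k` on a cycle of length `ℓ`. -/
noncomputable def cycleWeight (θ : ℕ → ℝ) (k ℓ : ℕ) : ℝ :=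
  ∑ j ∈ range k, θ j * (if ℓ ∣ j + 1 then ℓ else 0)

theorem weightedWalks_walkEdges (θ : ℕ → ℝ) (k : ℕ) {u : Fin (m + 1) → V}
    (hu : #(walkEdges u) = #(walkVerts u)) :
    weightedWalks θ k (walkEdges u) = cycleWeight θ k #(walkVerts u) := by
  simp_rw [weightedWalks, cycleWeight, numClosedWalks_walkEdges hu]

theorem walkCharFun_zero (θ : ℕ → ℝ) (k : ℕ) : walkCharFun V p θ k 0 = 1 := by
  simp only [walkCharFun, zero_mul, Complex.ofReal_zero, Complex.exp_zero]
  rw [← sum_smul, sum_bernoulliWeight, one_smul]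

theorem norm_walkCharFun_le (hp0 : 0 ≤ p) (hp1 : p ≤ 1) (θ : ℕ → ℝ) (k : ℕ) (t : ℝ) :
    ‖walkCharFun V p θ k t‖ ≤ 1 :=
  norm_sum_bernoulliWeight_smul_exp_le hp0 hp1 _

/-- The factor `weightedWalks θ k S` brought down by differentiation is a sum of indicators of
`walkEdges u ⊆ S`, and each indicator is traded for planting `u`. -/
theorem hasDerivAt_walkCharFun (θ : ℕ → ℝ) (k : ℕ) (t : ℝ) :
    HasDerivAt (walkCharFun V p θ k)
      (∑ j ∈ range k, (θ j * .I : ℂ) * ∑ u : Fin (j + 1) → V, p ^ #(walkEdges u) •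
        ∑ S : Finset (V × V), bernoulliWeight p S •
          Complex.exp ((t * weightedWalks θ k (S ∪ walkEdges u) : ℝ) * .I)) t := by
  have hexp : ∀ x : ℝ, HasDerivAt (fun t : ℝ => Complex.exp ((t * x : ℝ) * .I))
      (Complex.exp ((t * x : ℝ) * .I) * ((x : ℝ) * .I)) t := fun x => by
    have h := (((hasDerivAt_id t).mul_const x).ofReal_comp.mul_const Complex.I).cexp
    simpa using h
  have h1 : HasDerivAt (walkCharFun V p θ k) (∑ S : Finset (V × V), bernoulliWeight p S •
      (Complex.exp ((t * weightedWalks θ k S : ℝ) * .I) * ((weightedWalks θ k S : ℝ) * .I))) t :=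
    HasDerivAt.fun_sum fun S _ => (hexp (weightedWalks θ k S)).fun_const_smul (bernoulliWeight p S)
  refine h1.congr_deriv ?_
  have h2 : ∀ S : Finset (V × V), bernoulliWeight p S •
      (Complex.exp ((t * weightedWalks θ k S : ℝ) * .I) * ((weightedWalks θ k S : ℝ) * .I)) =
      ∑ j ∈ range k, (θ j * .I : ℂ) * ∑ u : Fin (j + 1) → V, bernoulliWeight p S •
        (if walkEdges u ⊆ S then Complex.exp ((t * weightedWalks θ k S : ℝ) * .I) else 0) := by
    intro S
    generalize Complex.exp ((t * weightedWalks θ k S : ℝ) * .I) = e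
    rw [weightedWalks, Complex.ofReal_sum, sum_mul, mul_sum, smul_sum]
    refine sum_congr rfl fun j _ => ?_
    rw [← smul_sum, ← sum_filter, sum_const, ← numClosedWalks, Complex.real_smul,
      Complex.real_smul, nsmul_eq_mul]
    push_cast
    ring
  rw [sum_congr rfl fun S _ => h2 S, sum_comm]
  refine sum_congr rfl fun j _ => ?_
  rw [← mul_sum]
  refine congrArg ((θ j * .I : ℂ) * ·) (sum_comm.trans (sum_congr rfl fun u _ => ?_))
  rw [sum_bernoulliWeight_smul_of_subset]

/-- The approximate differential equation for `walkCharFun`. -/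
theorem norm_deriv_walkCharFun_sub_le (hp0 : 0 ≤ p) (hp1 : p ≤ 1)
    (hpd : Fintype.card V * p ≤ d) (θ : ℕ → ℝ) (k : ℕ) (t : ℝ) :
    ‖deriv (walkCharFun V p θ k) t - (∑ j ∈ range k, (θ j * .I : ℂ) *
        ∑ u : Fin (j + 1) → V with #(walkEdges u) = #(walkVerts u), p ^ #(walkVerts u) •
          Complex.exp ((t * cycleWeight θ k #(walkVerts u) : ℝ) * .I)) * walkCharFun V p θ k t‖ ≤
      (∑ j ∈ range k, |θ j| * ((j + 1) + d) ^ (j + 1)) * ((1 + 2 * walkConst d k) * p) := by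
  have hd : 0 ≤ d := le_trans (by positivity) hpd
  have hK := walkConst_nonneg hd k
  rw [(hasDerivAt_walkCharFun θ k t).deriv, sum_mul, ← sum_sub_distrib, sum_mul]
  refine (norm_sum_le _ _).trans (sum_le_sum fun j hj => ?_)
  rw [mul_assoc (θ j * .I : ℂ) _ (walkCharFun V p θ k t), ← mul_sub, norm_mul, mul_assoc]
  have hθ : ‖(θ j * .I : ℂ)‖ = |θ j| := by simp
  rw [hθ]
  refine mul_le_mul_of_nonneg_left ?_ (abs_nonneg _)
  rw [sum_filter, sum_mul, ← sum_sub_distrib]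
  have hwalk := sum_pow_card_walkVerts_sdiff_le hp0 hpd ∅ (j + 1)
  simp only [sdiff_empty, card_empty, Nat.cast_zero, zero_add, Nat.cast_succ] at hwalk
  refine le_trans ?_ (mul_le_mul_of_nonneg_right hwalk (by positivity))
  rw [sum_mul]
  refine (norm_sum_le _ _).trans (sum_le_sum fun u _ => ?_)
  -- Cyclic walks cost the planting error `2 * walkConst d k * p`; every other walk has a surplus
  -- edge, hence a further factor `p`. The `1 +` in the bound serves the second case.
  split_ifs with hu
  · rw [smul_mul_assoc, hu, ← smul_sub, norm_smul, Real.norm_of_nonneg (by positivity)]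
    refine mul_le_mul_of_nonneg_left ?_ (by positivity)
    have h := norm_sum_exp_weightedWalks_union_sub_le hp0 hp1 hpd θ (mem_range.1 hj) u t
    rw [weightedWalks_walkEdges θ k hu] at h
    refine h.trans ?_
    nlinarith
  · rw [zero_mul, sub_zero, norm_smul, Real.norm_of_nonneg (by positivity)]
    have h1 : p ^ #(walkEdges u) ≤ p ^ #(walkVerts u) * p := by
      rw [← pow_succ]
      exact pow_le_pow_of_le_one hp0 hp1 (lt_of_le_of_ne (card_walkVerts_le u) (Ne.symm hu))
    have h2 := norm_sum_bernoulliWeight_smul_exp_le hp0 hp1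
      fun S => t * weightedWalks θ k (S ∪ walkEdges u)
    calc p ^ #(walkEdges u) * _ ≤ p ^ #(walkEdges u) * 1 :=
          mul_le_mul_of_nonneg_left h2 (by positivity)
      _ ≤ p ^ #(walkVerts u) * p := by rw [mul_one]; exact h1
      _ ≤ _ := mul_le_mul_of_nonneg_left (by nlinarith) (by positivity)

theorem sum_cyclicWalks_exp (θ : ℕ → ℝ) (t : ℝ) {j k : ℕ} (hj : j < k) :
    ∑ u : Fin (j + 1) → V with #(walkEdges u) = #(walkVerts u), p ^ #(walkVerts u) •
        Complex.exp ((t * cycleWeight θ k #(walkVerts u) : ℝ) * .I) =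
      ∑ q ∈ range k, if q + 1 ∣ j + 1 then
        ((Fintype.card V).descFactorial (q + 1) * p ^ (q + 1) : ℝ) •
          Complex.exp ((t * cycleWeight θ k (q + 1) : ℝ) * .I) else 0 := by
  rw [sum_cyclicWalks j fun ℓ => p ^ ℓ • Complex.exp ((t * cycleWeight θ k ℓ : ℝ) * .I)]
  rw [← sum_subset (range_subset_range.2 (Nat.succ_le_of_lt hj))]
  · refine sum_congr rfl fun q _ => ?_
    split_ifs
    · rw [mul_smul, Nat.cast_smul_eq_nsmul]
    · rw [zero_smul]
  · intro q _ hq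
    rw [if_neg]
    intro h
    have := Nat.le_of_dvd (Nat.succ_pos j) h
    exact hq (mem_range.2 (by omega))

end WalkCharFun

/-! ### Passage to the limit in the differential equation -/

section Limit

open Finset Filter Topology

/-- Solutions of `φ' = g φ + o(1)` with `φ 0 = 1` converge to the exponential of the antiderivative
of `g`. -/
theorem tendsto_of_approx_linear_ode {φ : ℕ → ℝ → ℂ} {g G : ℝ → ℂ} {ε : ℕ → ℝ}
    (hφ0 : ∀ n, φ n 0 = 1) (hφ : ∀ n, Differentiable ℝ (φ n)) (hG : ∀ t, HasDerivAt G (g t) t)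
    (hG0 : G 0 = 0) (hε : Tendsto ε atTop (𝓝 0))
    (hbound : ∀ᶠ n in atTop, ∀ t, ‖deriv (φ n) t - g t * φ n t‖ ≤ ε n) :
    Tendsto (fun n => φ n 1) atTop (𝓝 (Complex.exp (G 1))) := by
  have hcont : Continuous fun t => Complex.exp (-G t) := by
    have : Continuous G := continuous_iff_continuousAt.2 fun t => (hG t).continuousAt
    fun_prop
  obtain ⟨M, hM⟩ := isCompact_Icc.exists_bound_of_continuousOn (s := Set.Icc (0 : ℝ) 1)
    hcont.continuousOn
  have hderiv : ∀ n t, HasDerivAt (fun t => φ n t * Complex.exp (-G t))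
      ((deriv (φ n) t - g t * φ n t) * Complex.exp (-G t)) t := fun n t => by
    refine ((hφ n t).hasDerivAt.mul (hG t).neg.cexp).congr_deriv ?_
    rw [Pi.neg_apply]
    ring
  -- Integrating factor: on `[0, 1]` the derivative of `φ n * exp (-G)` is at most `ε n * M`.
  have hmain : Tendsto (fun n => φ n 1 * Complex.exp (-G 1)) atTop (𝓝 1) := by
    rw [tendsto_iff_norm_sub_tendsto_zero]
    refine squeeze_zero' (Eventually.of_forall fun n => norm_nonneg _) ?_
      (by simpa using hε.mul_const M)
    filter_upwards [hbound] with n hn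
    have h := norm_image_sub_le_of_norm_deriv_le_segment_01'
      (fun t _ => (hderiv n t).hasDerivWithinAt) (C := ε n * M) fun t ht => by
        rw [norm_mul]
        exact mul_le_mul (hn t) (hM t (Set.Ico_subset_Icc_self ht)) (norm_nonneg _)
          ((norm_nonneg _).trans (hn t))
    simpa [hφ0, hG0] using h
  have := hmain.mul_const (Complex.exp (G 1))
  simpa [mul_assoc, ← Complex.exp_add] using this

theorem tendsto_descFactorial_mul_div_pow (d : ℝ) (ℓ : ℕ) :
    Tendsto (fun n : ℕ => (n.descFactorial ℓ * (d / n) ^ ℓ : ℝ)) atTop (𝓝 (d ^ ℓ)) := by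
  have h1 : Tendsto (fun n : ℕ => (n.descFactorial ℓ / (n : ℝ) ^ ℓ : ℝ)) atTop (𝓝 1) := by
    refine (Asymptotics.isEquivalent_iff_tendsto_one ?_).1 (isEquivalent_descFactorial ℓ)
    filter_upwards [eventually_gt_atTop 0] with n hn
    positivity
  have h2 := h1.mul_const (d ^ ℓ)
  rw [one_mul] at h2
  refine h2.congr fun n => ?_
  rw [div_pow]
  ring

theorem tendsto_walkCharFun {d : ℝ} (hd : 0 < d) (θ : ℕ → ℝ) (k : ℕ) :
    Tendsto (fun n : ℕ => walkCharFun (Fin n) (d / n) θ k 1) atTop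
      (𝓝 (Complex.exp (∑ q ∈ range k, (d ^ (q + 1) / (q + 1 : ℕ) : ℝ) *
        (Complex.exp (cycleWeight θ k (q + 1) * .I) - 1)))) := by
  set g : ℝ → ℂ := fun t => ∑ j ∈ range k, (θ j * .I : ℂ) * ∑ q ∈ range k,
    if q + 1 ∣ j + 1 then
      (d ^ (q + 1) : ℝ) • Complex.exp ((t * cycleWeight θ k (q + 1) : ℝ) * .I) else 0 with hg
  -- In `G'` the denominator `q + 1` cancels against the factor `q + 1` in `cycleWeight`, the number
  -- of starting points on a cycle.
  set G : ℝ → ℂ := fun t => ∑ q ∈ range k, (d ^ (q + 1) / (q + 1 : ℕ) : ℝ) *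
    (Complex.exp ((t * cycleWeight θ k (q + 1) : ℝ) * .I) - 1) with hGdef
  -- The first summand is the error in the differential equation, the second that of replacing the
  -- number of injective walks times `p ^ (q + 1)` by its limit `d ^ (q + 1)`.
  set ε : ℕ → ℝ := fun n => (∑ j ∈ range k, |θ j| * ((j + 1) + d) ^ (j + 1)) *
      ((1 + 2 * walkConst d k) * (d / n)) +
    ∑ j ∈ range k, |θ j| * ∑ q ∈ range k,
      |n.descFactorial (q + 1) * (d / n) ^ (q + 1) - d ^ (q + 1)| with hεdef
  have hG : ∀ t, HasDerivAt G (g t) t := by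
    intro t
    have h1 : HasDerivAt G (∑ q ∈ range k, (d ^ (q + 1) / (q + 1 : ℕ) : ℝ) *
        (Complex.exp ((t * cycleWeight θ k (q + 1) : ℝ) * .I) *
          ((cycleWeight θ k (q + 1) : ℝ) * .I))) t := by
      refine HasDerivAt.fun_sum fun q _ => ?_
      have h := (((hasDerivAt_id t).mul_const (cycleWeight θ k (q + 1))).ofReal_comp.mul_const
        Complex.I).cexp.sub_const 1
      simpa using h.const_mul ((d ^ (q + 1) / (q + 1 : ℕ) : ℝ) : ℂ)
    refine h1.congr_deriv ?_
    simp_rw [hg, mul_sum]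
    rw [sum_comm]
    refine sum_congr rfl fun q _ => ?_
    generalize Complex.exp ((t * cycleWeight θ k (q + 1) : ℝ) * .I) = e
    rw [cycleWeight, Complex.ofReal_sum, sum_mul, mul_sum, mul_sum]
    refine sum_congr rfl fun j _ => ?_
    split_ifs
    · have : ((q : ℂ) + 1) ≠ 0 := by exact_mod_cast Nat.succ_ne_zero q
      rw [Complex.real_smul]
      push_cast
      field_simp
    · simp
  have hε : Tendsto ε atTop (𝓝 0) := by
    have h1 : Tendsto (fun n : ℕ => d / (n : ℝ)) atTop (𝓝 0) :=
      tendsto_const_div_atTop_nhds_zero_nat d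
    have h2 : ∀ q, Tendsto (fun n : ℕ =>
        |n.descFactorial (q + 1) * (d / n) ^ (q + 1) - d ^ (q + 1)|) atTop (𝓝 0) := fun q => by
      simpa using ((tendsto_descFactorial_mul_div_pow d (q + 1)).sub_const (d ^ (q + 1))).abs
    have h3 := ((h1.const_mul (1 + 2 * walkConst d k)).const_mul
      (∑ j ∈ range k, |θ j| * ((j + 1) + d) ^ (j + 1))).add
      (tendsto_finsetSum (range k) fun j _ =>
        (tendsto_finsetSum (range k) fun q _ => h2 q).const_mul |θ j|)
    simp only [mul_zero, sum_const_zero, add_zero] at h3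
    exact h3
  have hbound : ∀ᶠ n : ℕ in atTop, ∀ t, ‖deriv (walkCharFun (Fin n) (d / n) θ k) t -
      g t * walkCharFun (Fin n) (d / n) θ k t‖ ≤ ε n := by
    filter_upwards [eventually_ge_atTop (max 1 ⌈d⌉₊)] with n hn t
    have hn1 : (0 : ℝ) < n := by exact_mod_cast (le_max_left _ _).trans hn
    have hdn : d ≤ n := Nat.ceil_le.1 ((le_max_right _ _).trans hn)
    have hp0 : 0 ≤ d / n := by positivity
    have hp1 : d / n ≤ 1 := (div_le_one hn1).2 hdn
    have hpd : Fintype.card (Fin n) * (d / n) ≤ d := by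
      rw [Fintype.card_fin, mul_div_cancel₀ _ hn1.ne']
    have h1 := norm_deriv_walkCharFun_sub_le hp0 hp1 hpd θ k t
    refine (norm_sub_le_norm_sub_add_norm_sub _ _ _).trans (add_le_add h1 ?_)
    rw [← sub_mul, norm_mul]
    refine (mul_le_of_le_one_right (norm_nonneg _) (norm_walkCharFun_le hp0 hp1 θ k t)).trans ?_
    rw [hg, ← sum_sub_distrib]
    refine (norm_sum_le _ _).trans (sum_le_sum fun j hj => ?_)
    rw [← mul_sub, norm_mul]
    have hθ : ‖(θ j * .I : ℂ)‖ = |θ j| := by simp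
    rw [hθ, sum_cyclicWalks_exp θ t (mem_range.1 hj), Fintype.card_fin, ← sum_sub_distrib]
    refine mul_le_mul_of_nonneg_left ?_ (abs_nonneg _)
    refine (norm_sum_le _ _).trans (sum_le_sum fun q _ => ?_)
    split_ifs
    · rw [← sub_smul, norm_smul, Complex.norm_exp_ofReal_mul_I, mul_one, Real.norm_eq_abs]
    · simp
  have h := tendsto_of_approx_linear_ode (fun n => walkCharFun_zero (V := Fin n) θ k)
    (fun n t => (hasDerivAt_walkCharFun θ k t).differentiableAt) hG (by simp [hGdef]) hε hbound
  simpa [hGdef] using h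

end Limit

/-! ### Characteristic functions of the traces and of the Poisson sums -/

section Laws

open Finset MeasureTheory ProbabilityTheory

/-- The expectation of a function of finitely many independent Bernoulli variables. -/
theorem integral_comp_bernoulli {Ω α : Type*} [MeasurableSpace Ω] {P : Measure Ω}
    [IsProbabilityMeasure P] [Fintype α] [DecidableEq α] {X : α → Ω → ℝ} {p : unitInterval}
    (hX : iIndepFun X P) (hlaw : ∀ a, HasLaw (X a) (bernoulliMeasure 1 0 p) P)
    (F : (α → ℝ) → ℂ) :
    ∫ ω, F (fun a => X a ω) ∂P =
      ∑ S : Finset α, bernoulliWeight (p : ℝ) S • F (fun a => if a ∈ S then 1 else 0) := by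
  have h01 : ∀ᵐ ω ∂P, ∀ a, X a ω = 0 ∨ X a ω = 1 := by
    refine ae_all_iff.2 fun a => ?_
    have hset : MeasurableSet {x : ℝ | x = 0 ∨ x = 1} := by measurability
    have h : ∀ᵐ x ∂(bernoulliMeasure (1 : ℝ) 0 p), x = 0 ∨ x = 1 := by
      rw [bernoulliMeasure_def, ae_add_measure_iff]
      constructor
      · refine Measure.ae_smul_measure ?_ _
        rw [ae_dirac_iff hset]
        exact Or.inr rfl
      · refine Measure.ae_smul_measure ?_ _
        rw [ae_dirac_iff hset]
        exact Or.inl rfl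
    rw [← (hlaw a).map_eq] at h
    exact ae_of_ae_map (hlaw a).aemeasurable h
  -- On `0`-`1` vectors `F` agrees with its multilinear interpolation, whose expectation factors by
  -- independence.
  have hexpand : ∀ᵐ ω ∂P, F (fun a => X a ω) = ∑ S : Finset α,
      (∏ a, if a ∈ S then X a ω else 1 - X a ω) • F (fun a => if a ∈ S then 1 else 0) := by
    filter_upwards [h01] with ω hω
    rw [sum_eq_single ({a | X a ω = 1} : Finset α)]
    · rw [prod_eq_one, one_smul]
      · congr 1
        funext a
        rcases hω a with h | h <;> simp [h]
      · intro a _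
        rcases hω a with h | h <;> simp [h]
    · intro S _ hS
      obtain ⟨a, ha⟩ : ∃ a, ¬ (a ∈ S ↔ X a ω = 1) := by
        by_contra! h
        exact hS (by ext a; simpa using h a)
      rw [prod_eq_zero (mem_univ a), zero_smul]
      rcases hω a with h | h <;> by_cases haS : a ∈ S <;> simp_all
    · simp
  rw [integral_congr_ae hexpand, integral_finsetSum]
  · refine sum_congr rfl fun S _ => ?_
    rw [integral_smul_const]
    congr 1
    have h := hX.integral_fun_prod_comp (𝕜 := ℝ)
      (f := fun a x => if a ∈ S then x else 1 - x) (fun a => (hlaw a).aemeasurable) fun a => by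
        split_ifs <;> fun_prop
    rw [h, bernoulliWeight]
    refine prod_congr rfl fun a _ => ?_
    rw [← integral_map (hlaw a).aemeasurable (f := fun x : ℝ => if a ∈ S then x else 1 - x) (by
      split_ifs <;> fun_prop), (hlaw a).map_eq, integral_bernoulliMeasure]
    split_ifs <;> simp
  · intro S _
    refine Integrable.smul_const (Integrable.of_bound ?_ 1 ?_) _
    · refine AEMeasurable.aestronglyMeasurable (Finset.aemeasurable_fun_prod _ fun a _ => ?_)
      have := (hlaw a).aemeasurable
      split_ifs <;> fun_prop
    · filter_upwards [h01] with ω hω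
      rw [norm_prod]
      refine prod_le_one (fun _ _ => norm_nonneg _) fun a _ => ?_
      rcases hω a with h | h <;> split_ifs <;> simp [h]

theorem integral_exp_trace_eq_walkCharFun {n : ℕ} {Ω : Type*} [MeasurableSpace Ω] {P : Measure Ω}
    [IsProbabilityMeasure P] {A : Ω → Matrix (Fin n) (Fin n) ℝ} {p : unitInterval}
    (hA : iIndepFun (fun (e : Fin n × Fin n) ω => A ω e.1 e.2) P)
    (hlaw : ∀ i j, HasLaw (fun ω => A ω i j) (bernoulliMeasure 1 0 p) P) (θ : ℕ → ℝ) (k : ℕ) :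
    ∫ ω, Complex.exp ((∑ j ∈ range k, θ j * (A ω ^ (j + 1)).trace : ℝ) * .I) ∂P =
      walkCharFun (Fin n) p θ k 1 := by
  have h := integral_comp_bernoulli hA (fun e => hlaw e.1 e.2) fun x =>
    Complex.exp ((∑ j ∈ range k, θ j *
      ((Matrix.of fun a b => x (a, b)) ^ (j + 1)).trace : ℝ) * .I)
  refine h.trans ?_
  simp_rw [trace_indicator_pow_succ, walkCharFun, one_mul, weightedWalks]

/-- Exchanging the sums over multiples and divisors separates the independent variables: `Y ℓ` acts
as the number of cycles of length `ℓ`, each of weight `cycleWeight θ k ℓ`. -/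
theorem sum_mul_divisorSum {Ω : Type*} (Y : ℕ → Ω → ℕ) (θ : ℕ → ℝ) (k : ℕ) (ω : Ω) :
    ∑ j ∈ range k, θ j * divisorSum Y (j + 1) ω =
      ∑ q ∈ range k, cycleWeight θ k (q + 1) * Y (q + 1) ω := by
  have h : ∀ j ∈ range k, θ j * divisorSum Y (j + 1) ω = ∑ q ∈ range k,
      θ j * (if q + 1 ∣ j + 1 then (q + 1 : ℕ) else 0) * Y (q + 1) ω := by
    intro j hj
    have hdiv : (j + 1).divisors = {ℓ ∈ Ico 1 (k + 1) | ℓ ∣ j + 1} := by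
      ext ℓ
      rw [mem_range] at hj
      simp only [Nat.mem_divisors, mem_filter, mem_Ico]
      constructor
      · rintro ⟨h, -⟩
        have h1 := Nat.le_of_dvd (Nat.succ_pos j) h
        have h2 := Nat.pos_of_dvd_of_pos h (Nat.succ_pos j)
        exact ⟨by omega, h⟩
      · rintro ⟨-, h⟩
        exact ⟨h, Nat.succ_ne_zero j⟩
    rw [divisorSum, hdiv, sum_filter, sum_Ico_eq_sum_range, Nat.add_sub_cancel, Nat.cast_sum,
      mul_sum]
    refine sum_congr rfl fun q _ => ?_
    rw [add_comm 1 q]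
    split_ifs <;> push_cast <;> ring
  rw [sum_congr rfl h, sum_comm]
  simp_rw [← sum_mul, cycleWeight]

theorem integral_exp_divisorSum {d : ℝ} (hd : 0 < d) {Ω : Type*} [MeasurableSpace Ω]
    {Q : Measure Ω} [IsProbabilityMeasure Q] {Y : ℕ → Ω → ℕ}
    (hY_indep : iIndepFun (fun ℓ : ℕ+ => Y (ℓ : ℕ)) Q)
    (hY_law : ∀ ℓ : ℕ, 1 ≤ ℓ →
      HasLaw (Y ℓ) (poissonMeasure (Real.toNNReal (d ^ ℓ / (ℓ : ℝ)))) Q) (θ : ℕ → ℝ) (k : ℕ) :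
    ∫ ω, Complex.exp ((∑ j ∈ range k, θ j * divisorSum Y (j + 1) ω : ℝ) * .I) ∂Q =
      Complex.exp (∑ q ∈ range k, (d ^ (q + 1) / (q + 1 : ℕ) : ℝ) *
        (Complex.exp (cycleWeight θ k (q + 1) * .I) - 1)) := by
  have hind : iIndepFun (fun q : Fin k => Y (q + 1)) Q :=
    hY_indep.precomp (g := fun q : Fin k => Nat.succPNat q) fun a b h =>
      Fin.ext (Nat.succPNat_injective h)
  have hprod := hind.integral_fun_prod_comp (𝕜 := ℂ)
    (f := fun (q : Fin k) (y : ℕ) => Complex.exp ((cycleWeight θ k (q + 1) * (y : ℝ) : ℝ) * .I))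
    (fun q => (hY_law _ (Nat.succ_pos q)).aemeasurable) fun q =>
      (Measurable.of_discrete).aestronglyMeasurable
  simp_rw [sum_mul_divisorSum, sum_range, Complex.ofReal_sum, sum_mul, Complex.exp_sum]
  rw [hprod]
  refine prod_congr rfl fun q _ => ?_
  have hlaw := hY_law (q + 1) (Nat.succ_pos q)
  rw [← integral_map hlaw.aemeasurable
    (f := fun y : ℕ => Complex.exp ((cycleWeight θ k (q + 1) * (y : ℝ) : ℝ) * .I))
    (Measurable.of_discrete).aestronglyMeasurable, hlaw.map_eq]
  have h := charFun_map_cast_poissonMeasure (Real.toNNReal (d ^ ((q : ℕ) + 1) / ((q + 1 : ℕ) : ℝ)))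
    (cycleWeight θ k (q + 1))
  rw [charFun_apply_real, integral_map .of_discrete (by fun_prop)] at h
  rw [Real.coe_toNNReal _ (by positivity)] at h
  rw [← h]
  simp

end Laws

/-! ### Convergence in law by Lévy's continuity theorem -/

theorem theorem1
    (d : ℝ) (hd : 0 < d)
    -- the random `n × n` matrices `A n`, possibly on different probability spaces
    {Ω : ℕ → Type*} [∀ n, MeasurableSpace (Ω n)]
    (P : ∀ n, MeasureTheory.Measure (Ω n)) [∀ n, MeasureTheory.IsProbabilityMeasure (P n)]
    (A : ∀ n, Ω n → Matrix (Fin n) (Fin n) ℝ)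
    (hA_meas : ∀ n (i j : Fin n), AEMeasurable (fun ω => A n ω i j) (P n))
    -- as soon as `d / n ≤ 1`, the entries are independent with law `Bernoulli(d / n)`
    (hA_indep : ∀ n : ℕ, d ≤ (n : ℝ) →
      ProbabilityTheory.iIndepFun (fun (p : Fin n × Fin n) (ω : Ω n) => A n ω p.1 p.2) (P n))
    (hA_law : ∀ (n : ℕ) (hn : d ≤ (n : ℝ)) (i j : Fin n),
      ProbabilityTheory.HasLaw (fun ω => A n ω i j)
        (ProbabilityTheory.bernoulliMeasure (1 : ℝ) 0
          ⟨d / (n : ℝ), div_nonneg hd.le (Nat.cast_nonneg n),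
            div_le_one_of_le₀ hn (Nat.cast_nonneg n)⟩) (P n))
    -- the independent Poisson variables `Y ℓ`, `ℓ ≥ 1`
    {Ω' : Type*} [MeasurableSpace Ω']
    (Q : MeasureTheory.Measure Ω') [MeasureTheory.IsProbabilityMeasure Q]
    (Y : ℕ → Ω' → ℕ)
    (hY_indep : ProbabilityTheory.iIndepFun (fun ℓ : ℕ+ => Y (ℓ : ℕ)) Q)
    (hY_law : ∀ ℓ : ℕ, 1 ≤ ℓ →
      ProbabilityTheory.HasLaw (Y ℓ)
        (ProbabilityTheory.poissonMeasure (Real.toNNReal (d ^ ℓ / (ℓ : ℝ)))) Q)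
    (k : ℕ) :
    MeasureTheory.TendstoInDistribution
      (fun (n : ℕ) (ω : Ω n) (i : Fin k) => (A n ω ^ ((i : ℕ) + 1)).trace)
      Filter.atTop
      (fun (ω : Ω') (i : Fin k) => (divisorSum Y ((i : ℕ) + 1) ω : ℝ))
      P Q := by
  have htrace : ∀ n, AEMeasurable
      (fun ω => WithLp.toLp 2 fun i : Fin k => (A n ω ^ ((i : ℕ) + 1)).trace) (P n) := by
    intro n
    refine (WithLp.measurable_toLp 2 _).comp_aemeasurable (aemeasurable_pi_lambda _ fun i => ?_)
    simp_rw [trace_pow_succ_eq_sum]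
    exact Finset.aemeasurable_fun_sum _ fun u _ =>
      Finset.aemeasurable_fun_prod _ fun j _ => hA_meas n _ _
  have hsum : AEMeasurable
      (fun ω => WithLp.toLp 2 fun i : Fin k => (divisorSum Y ((i : ℕ) + 1) ω : ℝ)) Q := by
    refine (WithLp.measurable_toLp 2 _).comp_aemeasurable (aemeasurable_pi_lambda _ fun i => ?_)
    refine (Measurable.of_discrete (f := fun m : ℕ => (m : ℝ))).comp_aemeasurable ?_
    refine Finset.aemeasurable_fun_sum _ fun ℓ hℓ => ?_
    exact (hY_law ℓ (Nat.pos_of_mem_divisors hℓ)).aemeasurable.const_mul ℓ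
  -- Characteristic functions need an inner product, so convergence is proved in Euclidean space and
  -- then transported by the continuous map `ofLp`.
  have key : MeasureTheory.TendstoInDistribution
      (fun (n : ℕ) (ω : Ω n) => WithLp.toLp 2 fun i : Fin k => (A n ω ^ ((i : ℕ) + 1)).trace)
      Filter.atTop
      (fun ω => WithLp.toLp 2 fun i : Fin k => (divisorSum Y ((i : ℕ) + 1) ω : ℝ)) P Q := by
    refine ⟨htrace, hsum, MeasureTheory.ProbabilityMeasure.tendsto_of_tendsto_charFun fun t => ?_⟩
    -- The value `0` beyond `k` is immaterial: only indices below `k` enter the sums.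
    obtain ⟨θ, hθ⟩ : ∃ θ : ℕ → ℝ, ∀ i : Fin k, θ i = t i :=
      ⟨fun j => if h : j < k then t ⟨j, h⟩ else 0, fun i => by simp⟩
    have hinner : ∀ x : ℕ → ℝ, inner ℝ (WithLp.toLp 2 fun i : Fin k => x i) t =
        ∑ j ∈ Finset.range k, θ j * x j := fun x => by
      rw [PiLp.inner_apply, Finset.sum_range]
      simp [hθ]
    have hlim : MeasureTheory.charFun (Q.map fun ω => WithLp.toLp 2 fun i : Fin k =>
        (divisorSum Y ((i : ℕ) + 1) ω : ℝ)) t =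
        Complex.exp (∑ q ∈ Finset.range k, (d ^ (q + 1) / (q + 1 : ℕ) : ℝ) *
          (Complex.exp (cycleWeight θ k (q + 1) * .I) - 1)) := by
      rw [MeasureTheory.charFun_apply, MeasureTheory.integral_map hsum (by fun_prop),
        ← integral_exp_divisorSum hd hY_indep hY_law θ k]
      refine MeasureTheory.integral_congr_ae (Filter.Eventually.of_forall fun ω => ?_)
      simp only
      rw [hinner fun j => (divisorSum Y (j + 1) ω : ℝ)]
    simp only [MeasureTheory.ProbabilityMeasure.coe_mk]
    rw [hlim]
    refine (tendsto_walkCharFun hd θ k).congr' ?_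
    filter_upwards [Filter.eventually_ge_atTop ⌈d⌉₊] with n hn
    have hdn : d ≤ n := Nat.ceil_le.1 hn
    rw [MeasureTheory.charFun_apply, MeasureTheory.integral_map (htrace n) (by fun_prop)]
    refine (integral_exp_trace_eq_walkCharFun (hA_indep n hdn) (hA_law n hdn) θ k).symm.trans ?_
    refine MeasureTheory.integral_congr_ae (Filter.Eventually.of_forall fun ω => ?_)
    simp only
    rw [hinner fun j => (A n ω ^ (j + 1)).trace]
  exact key.continuous_comp (PiLp.continuous_ofLp 2 _)
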